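/- Fix a level $\alpha\in(0,1)$. A discrete cost distribution $\mathcal D$ consists of values $a_1<\dots<a_k$ in $[-\alpha,1-\alpha]$, at least one of them $\le 0$ and at least one $>0$, with probabilities $p_i>0$, $\sum_i p_i=1$. For a horizon $T$ let the costs $a^{(1)},\dots,a^{(T)}$ be i.i.d. from $\mathcal D$. Let $f^T_{\mathcal D}(\mathbf{HO_{any}})$ be the expectation of the maximum of $\sum_{t=1}^T X^{(t)}$ over $X\in\{0,1\}^T$ with $\sum_{s\le t}a^{(s)}X^{(s)}\le 0$ for all $t\in[T]$. For an online policy $\pi$ let $f^T_{\mathcal D}(\pi)$ be its expected number of accepted arrivals. The budget is $B^{(1)}=0$, $B^{(t+1)}=B^{(t)}-a^{(t)}\mathbf 1\{a^{(t)}\text{ accepted}\}$. For $b\ge 0$ let $x(b)$ be an optimal solution of the linear program (DLP): maximize $\sum_i p_ix_i$ subject to $\sum_i a_ip_ix_i\le b$ and $0\le x_i\le 1$ for all $i$. A re-solving heuristic has a set of re-solving periods containing period $1$. If $\tau\le t$ is the last re-solving period up to $t$, and the arrival of period $t$ has type $i$, then the arrival is accepted with probability $g(x_i)$, where $x=x\big(B^{(\tau)}/(T-\tau+1)\big)$,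 provided that the current budget covers the cost; otherwise it is rejected. "Covers" may be read either as $a_i\le B^{(t)}$ or as $a_i<B^{(t)}$, with the same reading throughout. The heuristics are: - $\mathbf{FR}$: re-solve in every period, $g(y)=y$; - $\mathbf{IFR}$: re-solve in an arbitrary set of periods containing period $1$; $g$ truncates probabilities, i.e. $g(0)=0$, $g(1)=1$, and for some thresholds $0\le \ell\le h\le 1$ it maps $y<\ell$ to $0$, $y>h$ to $1$, leaves $y\in(\ell,h)$ unchanged, and maps a threshold $y$ itself to $0$, $y$ or $1$; $g$ may depend on the re-solving period and on the type; - $\mathbf{FRT}$: as $\mathbf{IFR}$ with the same truncation rule, but re-solve in every period; - $\mathbf{Bayes}$ (Bayes Selector): re-solve in every period, $g(y)=\mathbf 1\{y\ge 1/2\}$. For every $\alpha\in(0,1)$ the following hold. 1. There is a distribution $\mathcal D$ such that (a) the DLP with $b=0$ is degenerate, i.e. $\sum_{j\le i}p_ja_j=0$ for some $i$ with $a_i>0$; (b) for every $T$, all re-solving sets and truncation rules, every choice of optimal solutions $x(\cdot)$ and either reading of "covers", each of $\mathbf{FR},\mathbf{IFR},\mathbf{FRT},\mathbf{Bayes}$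 takes, on every history with nonnegative budgets, the same decisions as the greedy policy, which accepts whenever the budget covers the cost; and (c) $$f_{\mathcal D}^T(\mathbf{HO_{any}})-\max\{f_{\mathcal D}^T(\mathbf{FR}),f_{\mathcal D}^T(\mathbf{IFR}),f_{\mathcal D}^T(\mathbf{FRT}),f_{\mathcal D}^T(\mathbf{Bayes})\}=\Omega(\sqrt T),$$ that is, there are $c>0$ and $T_0$ such that for all $T\ge T_0$ the left side is at least $c\sqrt T$, with $c$ and $T_0$ independent of the re-solving set, the truncation rule, the choice of optimal solutions and the reading of "covers". 2. There is a distribution $\mathcal D$ such that $f_{\mathcal D}^T(\mathbf{HO_{any}})-f_{\mathcal D}^T(\mathbf{Bayes})=\Omega(T)$: there are $c>0$ and $T_0$ such that for all $T\ge T_0$ the left side is at least $cT$, with $c$ and $T_0$ independent of the choice of optimal solutions and of the reading of "covers". -/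

import Mathlib

noncomputable section

/-- A discrete finite cost distribution for the level `α`: the cost takes the values
`a 0 < a 1 < ⋯ < a (k - 1)` in `[-α, 1 - α]`, at least one of them `≤ 0` and at least one `> 0`,
and takes the value `a i` with probability `p i > 0`. -/
structure CostDist (α : ℝ) where
  k : ℕ
  a : Fin k → ℝ
  p : Fin k → ℝ
  a_strictMono : StrictMono a
  a_mem : ∀ i, a i ∈ Set.Icc (-α) (1 - α)
  exists_nonpos : ∃ i, a i ≤ 0
  exists_pos : ∃ i, 0 < a i
  p_pos : ∀ i, 0 < p i
  p_sum : ∑ i, p i = 1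

namespace CostDist

variable {α : ℝ}

/-- The cumulative expected cost `Δ i = ∑_{j ≤ i} p j * a j`. -/
def cumCost (D : CostDist α) (i : Fin D.k) : ℝ :=
  ∑ j ∈ Finset.univ.filter (fun j => j ≤ i), D.p j * D.a j

/-- The deterministic linear program (with zero budget) is degenerate: the cumulative expected
cost vanishes at some type of positive cost. Its optimal solution then accepts exactly the types
up to that one: every variable sits at a bound and the budget constraint is tight. -/
def Degenerate (D : CostDist α) : Prop :=
  ∃ i, 0 < D.a i ∧ D.cumCost i = 0

/-- Feasible set of the deterministic linear program with budget `b` per period. -/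
def dlpFeasible (D : CostDist α) (b : ℝ) : Set (Fin D.k → ℝ) :=
  {x | (∀ i, 0 ≤ x i ∧ x i ≤ 1) ∧ ∑ i, D.a i * D.p i * x i ≤ b}

/-- `x` is an optimal solution of the deterministic linear program with budget `b` per period. -/
def IsDLPSolution (D : CostDist α) (b : ℝ) (x : Fin D.k → ℝ) : Prop :=
  x ∈ D.dlpFeasible b ∧ IsMaxOn (fun y => ∑ i, D.p i * y i) (D.dlpFeasible b) x

/-- `x` picks an optimal solution `x b` for every nonnegative budget `b` per period
(ties between optimal solutions are broken arbitrarily). -/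
def IsDLPSolver (D : CostDist α) (x : ℝ → Fin D.k → ℝ) : Prop :=
  ∀ b, 0 ≤ b → D.IsDLPSolution b (x b)

end CostDist

open Classical in
/-- Hindsight optimum with the any-time constraint on a path of costs `c`: the largest number of
accepted arrivals among all acceptance sets whose accumulated cost is `≤ 0` at every time. -/
def hoAny {T : ℕ} (c : Fin T → ℝ) : ℕ :=
  (Finset.univ.filter (fun S : Finset (Fin T) =>
    ∀ t, ∑ s ∈ S.filter (fun s => s ≤ t), c s ≤ 0)).sup Finset.card

namespace CostDist

variable {α : ℝ}

/-- Expected hindsight optimum for `T` i.i.d. arrivals. Period `t` in the usual numbering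
`1, …, T` is the element `t - 1` of `Fin T`; `ω t` is the type of the arrival in period `t`. -/
def expHOany (D : CostDist α) (T : ℕ) : ℝ :=
  ∑ ω : Fin T → Fin D.k, (∏ t, D.p (ω t)) * (hoAny (fun t => D.a (ω t)) : ℝ)

/-- The budget available at the start of period `t`, when the arrivals are `ω` and the decisions
are `X` (`X s = true` means that the arrival of period `s` is accepted). The initial budget
is zero. -/
def budget (D : CostDist α) {T : ℕ} (ω : Fin T → Fin D.k) (X : Fin T → Bool) (t : Fin T) : ℝ :=
  -∑ s ∈ Finset.univ.filter (fun s => s < t), if X s = true then D.a (ω s) else 0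

/-- A randomized policy: `π t ω X` is the probability of accepting the arrival `ω t` of period `t`
after the arrivals `ω s` and the decisions `X s` of the earlier periods `s < t`. All policies below
look at `ω` only up to `t` and at `X` only before `t`. -/
abbrev Policy (D : CostDist α) (T : ℕ) : Type :=
  Fin T → (Fin T → Fin D.k) → (Fin T → Bool) → ℝ

/-- Expected number of accepted arrivals under a policy: the sum over all arrival paths `ω` and
decision paths `X` of their joint probability times the number of acceptances. -/
def expReward (D : CostDist α) {T : ℕ} (π : D.Policy T) : ℝ :=
  ∑ ω : Fin T → Fin D.k, ∑ X : Fin T → Bool,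
    (∏ t, D.p (ω t) * (if X t = true then π t ω X else 1 - π t ω X)) *
      ((Finset.univ.filter (fun t => X t = true)).card : ℝ)

end CostDist

/-- The budget test: the budget `B` covers the cost `c`, in the strict form `c < B` or in the
non-strict form `c ≤ B`. -/
def Covers (strict : Bool) (c B : ℝ) : Prop :=
  if strict = true then c < B else c ≤ B

/-- The last re-solving period not later than `t`, for the set `R` of re-solving periods. -/
def lastResolve {T : ℕ} (R : Finset (Fin T)) (t : Fin T) : Fin T :=
  if h : (R.filter (fun s => s ≤ t)).Nonempty then (R.filter (fun s => s ≤ t)).max' h else t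

/-- `g` truncates probabilities: below a threshold `lo` to `0`, above a threshold `hi` to `1`, and
it changes nothing in between (at the thresholds themselves either convention is allowed). -/
def IsTruncation (g : ℝ → ℝ) : Prop :=
  g 0 = 0 ∧ g 1 = 1 ∧ ∃ lo hi : ℝ, 0 ≤ lo ∧ lo ≤ hi ∧ hi ≤ 1 ∧
    ∀ y, 0 ≤ y → y ≤ 1 →
      (g y = 0 ∨ g y = y ∨ g y = 1) ∧ (y < lo → g y = 0) ∧ (lo < y → y < hi → g y = y) ∧
        (hi < y → g y = 1)

namespace CostDist

variable {α : ℝ}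

open Classical in
/-- The greedy policy: accept whenever the budget covers the cost. -/
def greedy (D : CostDist α) (T : ℕ) (strict : Bool) : D.Policy T := fun t ω X =>
  if Covers strict (D.a (ω t)) (D.budget ω X t) then 1 else 0

open Classical in
/-- The re-solving framework. In period `t`, let `s` be the last re-solving period; the linear
program was solved in period `s` with the budget of that period divided by the number `T - s` of
periods from `s` on (`s` counts from `0`), with solution `x`. An arrival of type `i` whose cost is
covered by the current budget is accepted with probability `g s i (x i)`. -/
def resolve (D : CostDist α) (T : ℕ) (strict : Bool) (R : Finset (Fin T))
    (g : Fin T → Fin D.k → ℝ → ℝ) (x : ℝ → Fin D.k → ℝ) : D.Policy T := fun t ω X =>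
  if Covers strict (D.a (ω t)) (D.budget ω X t) then
    g (lastResolve R t) (ω t)
      (x (D.budget ω X (lastResolve R t) / ((T : ℝ) - ((lastResolve R t : ℕ) : ℝ))) (ω t))
  else 0

/-- Frequent Resolving: re-solve in every period and accept with probability `x i`. -/
def FR (D : CostDist α) (T : ℕ) (strict : Bool) (x : ℝ → Fin D.k → ℝ) : D.Policy T :=
  D.resolve T strict Finset.univ (fun _ _ y => y) x

/-- Infrequent Resolving: re-solve in the periods of `R` and accept with the truncated
probability. The truncation rule `g` may depend on the re-solving period and on the type. -/
def IFR (D : CostDist α) (T : ℕ) (strict : Bool) (R : Finset (Fin T))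
    (g : Fin T → Fin D.k → ℝ → ℝ) (x : ℝ → Fin D.k → ℝ) : D.Policy T :=
  D.resolve T strict R g x

/-- Frequent Resolving with Thresholding: as Infrequent Resolving, but re-solve in every period. -/
def FRT (D : CostDist α) (T : ℕ) (strict : Bool)
    (g : Fin T → Fin D.k → ℝ → ℝ) (x : ℝ → Fin D.k → ℝ) : D.Policy T :=
  D.resolve T strict Finset.univ g x

open Classical in
/-- Bayes Selector: re-solve in every period and accept if and only if `x i ≥ 1 / 2`. -/
def Bayes (D : CostDist α) (T : ℕ) (strict : Bool) (x : ℝ → Fin D.k → ℝ) : D.Policy T :=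
  D.resolve T strict Finset.univ (fun _ _ y => if 1 / 2 ≤ y then 1 else 0) x

/-- The policy takes the same decisions as the greedy policy on every history along which the
budget has never been negative (no other history can occur). -/
def ReducesToGreedy (D : CostDist α) {T : ℕ} (strict : Bool) (π : D.Policy T) : Prop :=
  ∀ t ω X, (∀ s, s ≤ t → 0 ≤ D.budget ω X s) → π t ω X = D.greedy T strict t ω X

end CostDist

end

/-!
Both distributions have the costs `-1`, `1`, `2`, scaled into `[-α, 1 - α]`. When the greedy budget
is low, the next arrivals may bring it to the value at which a cost `1` is just not covered, and
then have the costs `-1, -1, 2, 1, 1`. Greedy spends its budget on the `2` and rejects both `1`s;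
skipping the `2` pays for both `1`s, so it gains one acceptance and ends with the same budget. Hence
the expected gap between hindsight and greedy at time `T` is at least a constant times the expected
number of times before `T` at which the greedy budget `b` is low.

Greedy rejects only when its budget is low, so `b` drifts by minus the mean cost except at those
times. If the mean cost is positive, `b ≥ 0` forces their expected number to grow linearly. If the
mean is zero, their expected number is at least `E b / 2 ≥ E |S| / 4`, where `S` is the sum of all
costs, because `b ≥ max 0 (-S)` and `E S = 0`; and `E |S|` has order `√T` since `E S ^ 2` has order
`T` and `E S ^ 4` has order `T ^ 2`.

The heuristics are greedy on these instances because the linear program accepts almost everything.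
With mean zero its only solution is `x = 1`. With probabilities `1/2, 1/4, 1/4` the point
`(1, 1, 1/2)` is feasible, so a solution rejects with total probability at most `1/8`, and every
`x i` is at least `1/2`, which the Bayes selector rounds up to `1`.
-/

/-- The budget after an arrival of cost `c`, for the greedy rule on integer costs. The margin `δ`
encodes the budget test: `δ = 0` is the test `c ≤ b` and `δ = 1` is the test `c < b`. -/
def greedyStep (δ b c : ℤ) : ℤ := if c + δ ≤ b then b - c else b

/-- The greedy budget after the arrivals `l`, from the initial budget `b`. -/
def greedyBudget (δ b : ℤ) (l : List ℤ) : ℤ := l.foldl (greedyStep δ) b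

/-- The number of arrivals of `l` accepted by the greedy rule, from the initial budget `b`. -/
def greedyCount (δ : ℤ) : ℤ → List ℤ → ℕ
  | _, [] => 0
  | b, c :: l => (if c + δ ≤ b then 1 else 0) + greedyCount δ (greedyStep δ b c) l

/-- `Reaches b l n b'` says that, from the budget `b`, some `n` of the arrivals `l` can be accepted
with no acceptance exceeding the current budget, leaving the budget `b'`. -/
inductive Reaches : ℤ → List ℤ → ℕ → ℤ → Prop
  | nil (b : ℤ) : Reaches b [] 0 b
  | reject {b b' : ℤ} {n : ℕ} {l : List ℤ} (c : ℤ) :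
      Reaches b l n b' → Reaches b (c :: l) n b'
  | accept {b b' : ℤ} {n : ℕ} {l : List ℤ} (c : ℤ) (hc : c ≤ b) :
      Reaches (b - c) l n b' → Reaches b (c :: l) (n + 1) b'

section Greedy

variable {δ b : ℤ}

lemma greedyStep_nonneg (hδ : 0 ≤ δ) (hb : 0 ≤ b) (c : ℤ) : 0 ≤ greedyStep δ b c := by
  unfold greedyStep
  split_ifs <;> omega

lemma greedyBudget_append (l w : List ℤ) :
    greedyBudget δ b (l ++ w) = greedyBudget δ (greedyBudget δ b l) w :=
  List.foldl_append

lemma greedyBudget_concat (l : List ℤ) (c : ℤ) :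
    greedyBudget δ b (l ++ [c]) = greedyStep δ (greedyBudget δ b l) c :=
  greedyBudget_append l [c]

lemma greedyBudget_nonneg (hδ : 0 ≤ δ) (hb : 0 ≤ b) (l : List ℤ) : 0 ≤ greedyBudget δ b l :=
  List.foldlRecOn l _ hb fun _ hb c _ => greedyStep_nonneg hδ hb c

lemma sub_sum_le_greedyBudget (hδ : 0 ≤ δ) (hδ1 : δ ≤ 1) (hb : 0 ≤ b) (l : List ℤ) :
    b - l.sum ≤ greedyBudget δ b l := by
  induction l generalizing b with
  | nil => simp [greedyBudget]
  | cons c l ih =>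
    have hstep : b - c ≤ greedyStep δ b c := by unfold greedyStep; split_ifs <;> omega
    have hrest := ih (greedyStep_nonneg hδ hb c)
    simp only [List.sum_cons, greedyBudget, List.foldl_cons] at hrest ⊢
    omega

lemma greedyCount_append (l w : List ℤ) :
    greedyCount δ b (l ++ w) = greedyCount δ b l + greedyCount δ (greedyBudget δ b l) w := by
  induction l generalizing b with
  | nil => simp [greedyCount, greedyBudget]
  | cons c l ih => simp [greedyCount, greedyBudget, ih, add_assoc]

lemma Reaches.append {l w : List ℤ} {n k : ℕ} {b' b'' : ℤ} (hl : Reaches b l n b')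
    (hw : Reaches b' w k b'') : Reaches b (l ++ w) (n + k) b'' := by
  induction hl with
  | nil => simpa using hw
  | reject c _ ih => exact (ih hw).reject c
  | accept c hc _ ih => exact add_right_comm _ 1 k ▸ (ih hw).accept c hc

lemma Reaches.le_length {l : List ℤ} {n : ℕ} {b' : ℤ} (h : Reaches b l n b') :
    n ≤ l.length := by
  induction h with
  | nil => rfl
  | reject _ _ ih => exact ih.trans (Nat.le_succ _)
  | accept _ _ _ ih => exact Nat.succ_le_succ ih

lemma reaches_greedy (hδ : 0 ≤ δ) (l : List ℤ) :
    Reaches b l (greedyCount δ b l) (greedyBudget δ b l) := by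
  induction l generalizing b with
  | nil => exact .nil b
  | cons c l ih =>
    by_cases hc : c + δ ≤ b
    · have hstep : greedyStep δ b c = b - c := if_pos hc
      rw [greedyCount, if_pos hc, hstep, add_comm, greedyBudget, List.foldl_cons, hstep]
      exact .accept c (by omega) ih
    · have hstep : greedyStep δ b c = b := if_neg hc
      rw [greedyCount, if_neg hc, hstep, zero_add, greedyBudget, List.foldl_cons, hstep]
      exact .reject c ih

/-- How many more of the arrivals `l` than greedy one can accept, from the budget `0`, while leaving
the same budget as greedy. -/
noncomputable def greedySurplus (δ : ℤ) (l : List ℤ) : ℕ :=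
  sSup {n | Reaches 0 l (greedyCount δ 0 l + n) (greedyBudget δ 0 l)}

lemma bddAbove_surplus (δ : ℤ) (l : List ℤ) :
    BddAbove {n | Reaches 0 l (greedyCount δ 0 l + n) (greedyBudget δ 0 l)} :=
  ⟨l.length, fun _ h => (Nat.le_add_left _ _).trans h.le_length⟩

lemma reaches_greedySurplus (hδ : 0 ≤ δ) (l : List ℤ) :
    Reaches 0 l (greedyCount δ 0 l + greedySurplus δ l) (greedyBudget δ 0 l) :=
  Nat.sSup_mem ⟨0, reaches_greedy hδ l⟩ (bddAbove_surplus δ l)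

lemma greedySurplus_add_le_append (hδ : 0 ≤ δ) {l w : List ℤ} {k : ℕ}
    (hw : Reaches (greedyBudget δ 0 l) w (greedyCount δ (greedyBudget δ 0 l) w + k)
      (greedyBudget δ (greedyBudget δ 0 l) w)) :
    greedySurplus δ l + k ≤ greedySurplus δ (l ++ w) := by
  refine le_csSup (bddAbove_surplus δ _) ?_
  rw [Set.mem_ofPred_eq, greedyCount_append, greedyBudget_append, add_add_add_comm]
  exact (reaches_greedySurplus hδ l).append hw

lemma greedySurplus_le_append (hδ : 0 ≤ δ) (l w : List ℤ) :
    greedySurplus δ l ≤ greedySurplus δ (l ++ w) :=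
  greedySurplus_add_le_append (k := 0) hδ (reaches_greedy hδ w)

/-- The costs of both instances, before scaling. -/
def baseCost : Fin 3 → ℤ := ![-1, 1, 2]

lemma reaches_greedyCount_add_one (hδ : 0 ≤ δ) :
    Reaches δ [-1, -1, 2, 1, 1] (greedyCount δ δ [-1, -1, 2, 1, 1] + 1)
      (greedyBudget δ δ [-1, -1, 2, 1, 1]) := by
  have hup : greedyStep δ δ (-1) = δ + 1 := by simp [greedyStep]
  have hup' : greedyStep δ (δ + 1) (-1) = δ + 2 := by
    simp only [greedyStep]
    split_ifs <;> omega
  have hdown : greedyStep δ (δ + 2) 2 = δ := by simp [greedyStep, add_comm]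
  have hstay : greedyStep δ δ 1 = δ := by simp [greedyStep]
  have hcount : greedyCount δ δ [-1, -1, 2, 1, 1] = 3 := by
    simp [greedyCount, hup, hup', hdown, hstay, add_comm]
  have hbudget : greedyBudget δ δ [-1, -1, 2, 1, 1] = δ := by
    simp [greedyBudget, hup, hup', hdown, hstay]
  have hreach : Reaches δ [-1, -1, 2, 1, 1] 4 (δ - -1 - -1 - 1 - 1) :=
    .accept _ (by omega) <| .accept _ (by omega) <| .reject _ <| .accept _ (by omega) <|
      .accept _ (by omega) <| .nil _
  rw [hcount, hbudget]
  convert hreach using 1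
  ring

lemma exists_greedyStep_eq (hδ1 : δ ≤ 1) (hb : 0 ≤ b) (hlow : b < δ + 2) :
    ∃ i, greedyStep δ b (baseCost i) = δ := by
  rcases lt_or_ge b δ with h | h
  · exact ⟨0, by
      simp only [greedyStep, baseCost, Matrix.cons_val]
      split_ifs <;> omega⟩
  · exact ⟨1, by
      simp only [greedyStep, baseCost, Matrix.cons_val]
      split_ifs <;> omega⟩

lemma exists_reaches_greedyCount_add_one (hδ : 0 ≤ δ) (hδ1 : δ ≤ 1) (hb : 0 ≤ b)
    (hlow : b < δ + 2) :
    ∃ w : Fin 6 → Fin 3, Reaches b (List.ofFn fun t => baseCost (w t))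
      (greedyCount δ b (List.ofFn fun t => baseCost (w t)) + 1)
      (greedyBudget δ b (List.ofFn fun t => baseCost (w t))) := by
  obtain ⟨i, hi⟩ := exists_greedyStep_eq hδ1 hb hlow
  have hw : List.ofFn (fun t => baseCost (![i, 0, 0, 2, 1, 1] t)) =
      [baseCost i] ++ [-1, -1, 2, 1, 1] := by
    simp [List.ofFn_succ, baseCost]
  have hstep : greedyBudget δ b [baseCost i] = δ := hi
  refine ⟨![i, 0, 0, 2, 1, 1], ?_⟩
  rw [hw, greedyCount_append, greedyBudget_append, add_assoc]
  refine (reaches_greedy hδ _).append ?_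
  rw [hstep]
  exact reaches_greedyCount_add_one hδ

end Greedy

section PathExp

variable {ι β : Type*} [Fintype ι]

/-- The expectation of `F` on the path of the values `v` of `T` independent arrivals, each of which
has type `i` with probability `p i`. -/
noncomputable def pathExp (p : ι → ℝ) (v : ι → β) (T : ℕ) (F : List β → ℝ) : ℝ :=
  ∑ ω : Fin T → ι, (∏ t, p (ω t)) * F (List.ofFn fun t => v (ω t))

variable {p : ι → ℝ} {v : ι → β}

lemma pathExp_zero (F : List β → ℝ) : pathExp p v 0 F = F [] := by simp [pathExp]

lemma pathExp_append (T n : ℕ) (F : List β → ℝ) :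
    pathExp p v (T + n) F = pathExp p v T fun l => pathExp p v n fun w => F (l ++ w) := by
  simp only [pathExp, Finset.mul_sum]
  rw [← (Fin.appendEquiv T n).sum_comp, Fintype.sum_prod_type]
  refine Finset.sum_congr rfl fun ω _ => Finset.sum_congr rfl fun η _ => ?_
  have hpath : (fun t => v (Fin.append ω η t)) =
      Fin.append (fun t => v (ω t)) fun t => v (η t) := by
    funext t
    refine Fin.addCases (fun s => ?_) (fun s => ?_) t <;> simp
  simp only [Fin.appendEquiv, Equiv.coe_fn_mk, hpath, List.ofFn_fin_append, Fin.prod_univ_add,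
    Fin.append_left, Fin.append_right, mul_assoc]

lemma pathExp_succ (T : ℕ) (F : List β → ℝ) :
    pathExp p v (T + 1) F = pathExp p v T fun l => ∑ i, p i * F (l ++ [v i]) := by
  have hone (G : List β → ℝ) : pathExp p v 1 G = ∑ i, p i * G [v i] := by
    rw [pathExp, ← (Equiv.funUnique (Fin 1) ι).symm.sum_comp]
    simp
  simp only [pathExp_append, hone]

lemma pathExp_comp {γ : Type*} (f : β → γ) (T : ℕ) (F : List γ → ℝ) :
    pathExp p (fun i => f (v i)) T F = pathExp p v T fun l => F (l.map f) := by
  simp only [pathExp, List.map_ofFn, Function.comp_def]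

lemma pathExp_mono (hp : ∀ i, 0 ≤ p i) {F G : List β → ℝ} (h : ∀ l, F l ≤ G l) (T : ℕ) :
    pathExp p v T F ≤ pathExp p v T G :=
  Finset.sum_le_sum fun _ _ =>
    mul_le_mul_of_nonneg_left (h _) (Finset.prod_nonneg fun _ _ => hp _)

lemma pathExp_nonneg (hp : ∀ i, 0 ≤ p i) {F : List β → ℝ} (hF : ∀ l, 0 ≤ F l) (T : ℕ) :
    0 ≤ pathExp p v T F :=
  Finset.sum_nonneg fun _ _ => mul_nonneg (Finset.prod_nonneg fun _ _ => hp _) (hF _)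

lemma pathExp_add (T : ℕ) (F G : List β → ℝ) :
    pathExp p v T (fun l => F l + G l) = pathExp p v T F + pathExp p v T G := by
  simp only [pathExp, mul_add, Finset.sum_add_distrib]

lemma pathExp_const_mul (T : ℕ) (a : ℝ) (F : List β → ℝ) :
    pathExp p v T (fun l => a * F l) = a * pathExp p v T F := by
  simp only [pathExp, Finset.mul_sum, mul_left_comm]

lemma pathExp_const (hsum : ∑ i, p i = 1) (T : ℕ) (a : ℝ) : pathExp p v T (fun _ => a) = a := by
  rw [pathExp, ← Finset.sum_mul, ← Fintype.sum_pow, hsum, one_pow, one_mul]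

lemma add_pow_le_pathExp {m a : ℝ} {n : ℕ} {F : List β → ℝ} (hm : 0 ≤ m) (hp : ∀ i, m ≤ p i)
    (hsum : ∑ i, p i = 1) (hF : ∀ l, a ≤ F l) (w : Fin n → ι)
    (hw : a + 1 ≤ F (List.ofFn fun t => v (w t))) :
    a + m ^ n ≤ pathExp p v n F := by
  have hp0 (ω : Fin n → ι) : 0 ≤ ∏ t, p (ω t) := Finset.prod_nonneg fun _ _ => hm.trans (hp _)
  have hprod : m ^ n ≤ ∏ t, p (w t) := by
    simpa using Finset.prod_le_prod (s := Finset.univ) (fun _ _ => hm) fun t _ => hp (w t)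
  have hsingle : (∏ t, p (w t)) * 1 ≤
      pathExp p v n fun l => F l + -a := by
    refine le_trans ?_ (Finset.single_le_sum
      (fun ω _ => mul_nonneg (hp0 ω) (by linarith [hF (List.ofFn fun t => v (ω t))]))
      (Finset.mem_univ w))
    exact mul_le_mul_of_nonneg_left (by linarith) (hp0 w)
  rw [pathExp_add, pathExp_const hsum] at hsingle
  linarith

lemma pathExp_add_pow_mul_le {m : ℝ} {n : ℕ} {F : List β → ℝ} {P : List β → Prop}
    [DecidablePred P] (hm : 0 ≤ m) (hp : ∀ i, m ≤ p i) (hsum : ∑ i, p i = 1)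
    (hF : ∀ l w, F l ≤ F (l ++ w))
    (hP : ∀ l, P l → ∃ w : Fin n → ι, F l + 1 ≤ F (l ++ List.ofFn fun t => v (w t))) (T : ℕ) :
    pathExp p v T F + m ^ n * pathExp p v T (fun l => if P l then 1 else 0) ≤
      pathExp p v (T + n) F := by
  have hp0 (i : ι) : 0 ≤ p i := hm.trans (hp i)
  rw [pathExp_append, ← pathExp_const_mul, ← pathExp_add]
  refine pathExp_mono hp0 (fun l => ?_) T
  split_ifs with hl
  · obtain ⟨w, hw⟩ := hP l hl
    rw [mul_one]
    exact add_pow_le_pathExp hm hp hsum (hF l) w hw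
  · rw [mul_zero, add_zero]
    calc F l = pathExp p v n fun _ => F l := (pathExp_const hsum n (F l)).symm
      _ ≤ pathExp p v n fun w => F (l ++ w) := pathExp_mono hp0 (hF l) n

lemma monotone_pathExp (hp : ∀ i, 0 ≤ p i) (hsum : ∑ i, p i = 1) {F : List β → ℝ}
    (hF : ∀ l w, F l ≤ F (l ++ w)) : Monotone fun T => pathExp p v T F := by
  refine monotone_nat_of_le_succ fun T => ?_
  rw [pathExp_succ]
  refine pathExp_mono hp (fun l => ?_) T
  calc F l = ∑ i, p i * F l := by rw [← Finset.sum_mul, hsum, one_mul]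
    _ ≤ ∑ i, p i * F (l ++ [v i]) :=
      Finset.sum_le_sum fun i _ => mul_le_mul_of_nonneg_left (hF l _) (hp i)

end PathExp

lemma sum_range_shift_sub_le {a : ℕ → ℝ} (ha : Monotone a) (h0 : ∀ t, 0 ≤ a t) (n T : ℕ) :
    ∑ t ∈ Finset.range T, (a (t + n) - a t) ≤ n * a (T + n) := by
  induction n with
  | zero => simp
  | succ n ih =>
    have htel : ∑ t ∈ Finset.range T, (a (t + (n + 1)) - a (t + n)) = a (T + n) - a n := by
      simpa only [add_right_comm _ 1 n, add_assoc, zero_add] using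
        Finset.sum_range_sub (fun t => a (t + n)) T
    have hsplit : ∑ t ∈ Finset.range T, (a (t + (n + 1)) - a t) =
        ∑ t ∈ Finset.range T, (a (t + n) - a t) +
          ∑ t ∈ Finset.range T, (a (t + (n + 1)) - a (t + n)) := by
      rw [← Finset.sum_add_distrib]
      exact Finset.sum_congr rfl fun _ _ => by ring
    have hmono : a (T + n) ≤ a (T + (n + 1)) := ha (Nat.le_succ _)
    have hn : (n : ℝ) * a (T + n) ≤ n * a (T + (n + 1)) :=
      mul_le_mul_of_nonneg_left hmono n.cast_nonneg
    push_cast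
    linarith [h0 n]

section RandomWalk

variable {ι : Type*} [Fintype ι] {p v : ι → ℝ}

lemma pathExp_sum (hsum : ∑ i, p i = 1) (T : ℕ) :
    pathExp p v T List.sum = T * ∑ i, p i * v i := by
  induction T with
  | zero => simp [pathExp_zero]
  | succ T ih =>
    simp only [pathExp_succ, List.sum_append, List.sum_singleton, mul_add, Finset.sum_add_distrib,
      ← Finset.sum_mul, hsum, one_mul]
    rw [pathExp_add, pathExp_const hsum, ih]
    push_cast
    ring

lemma pathExp_sum_sq (hsum : ∑ i, p i = 1) (hmean : ∑ i, p i * v i = 0) (T : ℕ) :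
    pathExp p v T (fun l => l.sum ^ 2) = T * ∑ i, p i * v i ^ 2 := by
  induction T with
  | zero => simp [pathExp_zero]
  | succ T ih =>
    have hexpand (s : ℝ) : ∑ i, p i * (s + v i) ^ 2 = s ^ 2 + ∑ i, p i * v i ^ 2 := by
      calc ∑ i, p i * (s + v i) ^ 2
          = (∑ i, p i) * s ^ 2 + 2 * s * ∑ i, p i * v i + ∑ i, p i * v i ^ 2 := by
            simp only [Finset.mul_sum, Finset.sum_mul, ← Finset.sum_add_distrib]
            exact Finset.sum_congr rfl fun i _ => by ring
        _ = s ^ 2 + ∑ i, p i * v i ^ 2 := by rw [hsum, hmean]; ring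
    simp only [pathExp_succ, List.sum_append, List.sum_singleton, hexpand]
    rw [pathExp_add, pathExp_const hsum, ih]
    push_cast
    ring

lemma pathExp_sum_pow_four (hsum : ∑ i, p i = 1) (hmean : ∑ i, p i * v i = 0) (T : ℕ) :
    pathExp p v T (fun l => l.sum ^ 4) =
      3 * T * (T - 1) * (∑ i, p i * v i ^ 2) ^ 2 + T * ∑ i, p i * v i ^ 4 := by
  induction T with
  | zero => simp [pathExp_zero]
  | succ T ih =>
    have hexpand (s : ℝ) : ∑ i, p i * (s + v i) ^ 4 = s ^ 4 + ((6 * ∑ i, p i * v i ^ 2) * s ^ 2 +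
        ((4 * ∑ i, p i * v i ^ 3) * s + ∑ i, p i * v i ^ 4)) := by
      calc ∑ i, p i * (s + v i) ^ 4
          = (∑ i, p i) * s ^ 4 + 4 * s ^ 3 * ∑ i, p i * v i + ((6 * ∑ i, p i * v i ^ 2) * s ^ 2 +
              ((4 * ∑ i, p i * v i ^ 3) * s + ∑ i, p i * v i ^ 4)) := by
            simp only [Finset.mul_sum, Finset.sum_mul, ← Finset.sum_add_distrib]
            exact Finset.sum_congr rfl fun i _ => by ring
        _ = _ := by rw [hsum, hmean]; ring
    simp only [pathExp_succ, List.sum_append, List.sum_singleton, hexpand]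
    rw [pathExp_add, pathExp_add, pathExp_add, pathExp_const_mul, pathExp_const_mul,
      pathExp_const hsum, pathExp_sum_sq hsum hmean, pathExp_sum hsum, hmean, ih]
    push_cast
    ring

end RandomWalk

lemma sum_mul_sq_pow_three_le {κ : Type*} (s : Finset κ) {w : κ → ℝ} (hw : ∀ i ∈ s, 0 ≤ w i)
    (f : κ → ℝ) :
    (∑ i ∈ s, w i * f i ^ 2) ^ 3 ≤ (∑ i ∈ s, w i * |f i|) ^ 2 * ∑ i ∈ s, w i * f i ^ 4 := by
  -- Cauchy–Schwarz twice, through the third absolute moment `C`.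
  set A := ∑ i ∈ s, w i * |f i|
  set B := ∑ i ∈ s, w i * f i ^ 2
  set C := ∑ i ∈ s, w i * |f i| ^ 3
  set D := ∑ i ∈ s, w i * f i ^ 4
  have hBAC : B ^ 2 ≤ A * C := Finset.sum_sq_le_sum_mul_sum_of_sq_le_mul s
    (fun i hi => mul_nonneg (hw i hi) (abs_nonneg _))
    (fun i hi => mul_nonneg (hw i hi) (by positivity))
    (fun i _ => by rw [← sq_abs (f i)]; exact le_of_eq (by ring))
  have hCBD : C ^ 2 ≤ B * D := Finset.sum_sq_le_sum_mul_sum_of_sq_le_mul s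
    (fun i hi => mul_nonneg (hw i hi) (sq_nonneg _))
    (fun i hi => mul_nonneg (hw i hi) (by positivity))
    (fun i _ => by
      have hfour : f i ^ 4 = |f i| ^ 4 := (Even.pow_abs (by decide) _).symm
      rw [← sq_abs (f i), hfour]
      exact le_of_eq (by ring))
  have hB : 0 ≤ B := Finset.sum_nonneg fun i hi => mul_nonneg (hw i hi) (sq_nonneg _)
  have hD : 0 ≤ D := Finset.sum_nonneg fun i hi => mul_nonneg (hw i hi) (by positivity)
  rcases hB.eq_or_lt with hB0 | hBpos
  · rw [← hB0, zero_pow three_ne_zero]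
    exact mul_nonneg (sq_nonneg A) hD
  · refine le_of_mul_le_mul_left ?_ hBpos
    calc B * B ^ 3 = (B ^ 2) ^ 2 := by ring
      _ ≤ (A * C) ^ 2 := pow_le_pow_left₀ (sq_nonneg B) hBAC 2
      _ = A ^ 2 * C ^ 2 := mul_pow A C 2
      _ ≤ A ^ 2 * (B * D) := mul_le_mul_of_nonneg_left hCBD (sq_nonneg A)
      _ = B * (A ^ 2 * D) := by ring

lemma pathExp_abs_sum_sq_ge {ι : Type*} [Fintype ι] {p v : ι → ℝ} (hp : ∀ i, 0 ≤ p i)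
    (hsum : ∑ i, p i = 1) (hmean : ∑ i, p i * v i = 0) (T : ℕ) :
    (∑ i, p i * v i ^ 2) ^ 3 * T ≤
      (3 * (∑ i, p i * v i ^ 2) ^ 2 + ∑ i, p i * v i ^ 4) *
        pathExp p v T (fun l => |l.sum|) ^ 2 := by
  set σ2 := ∑ i, p i * v i ^ 2
  set κ := ∑ i, p i * v i ^ 4
  have hκ : 0 ≤ κ := Finset.sum_nonneg fun i _ => mul_nonneg (hp i) (by positivity)
  rcases T.eq_zero_or_pos with rfl | hT
  · simpa using by positivity
  have hT1 : (1 : ℝ) ≤ T := by exact_mod_cast hT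
  have hinterp : pathExp p v T (fun l => l.sum ^ 2) ^ 3 ≤
      pathExp p v T (fun l => |l.sum|) ^ 2 * pathExp p v T fun l => l.sum ^ 4 :=
    sum_mul_sq_pow_three_le _ (fun _ _ => Finset.prod_nonneg fun _ _ => hp _) _
  rw [pathExp_sum_sq hsum hmean, pathExp_sum_pow_four hsum hmean] at hinterp
  have hfour : 3 * T * (T - 1) * σ2 ^ 2 + T * κ ≤ (3 * σ2 ^ 2 + κ) * (T : ℝ) ^ 2 := by
    nlinarith [mul_nonneg hκ (sub_nonneg.2 hT1), sq_nonneg σ2,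
      mul_nonneg (mul_nonneg hκ (sub_nonneg.2 hT1)) (zero_le_one.trans hT1)]
  have hbound := hinterp.trans (mul_le_mul_of_nonneg_left hfour (sq_nonneg _))
  refine le_of_mul_le_mul_right ?_ (by positivity : (0 : ℝ) < T ^ 2)
  linarith

section Drift

variable {ι : Type*} [Fintype ι] {p : ι → ℝ} {δ : ℤ}

/-- The expected number of times `t < T` at which the greedy budget, started at `0`, lies below
`h`. -/
noncomputable def expVisitsBelow (p : ι → ℝ) (v : ι → ℤ) (δ h : ℤ) (T : ℕ) : ℝ :=
  ∑ t ∈ Finset.range T, pathExp p v t fun l => if greedyBudget δ 0 l < h then 1 else 0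

lemma greedyStep_add_le {C c : ℤ} (hC : 0 ≤ C) (hc : c ≤ C) (b : ℤ) :
    greedyStep δ b c + c ≤ b + C * if b < δ + C then 1 else 0 := by
  unfold greedyStep
  split_ifs <;> omega

lemma pathExp_greedyBudget_add_le {v : ι → ℤ} {C : ℤ} (hp : ∀ i, 0 ≤ p i) (hsum : ∑ i, p i = 1)
    (hC : 0 ≤ C) (hv : ∀ i, v i ≤ C) (T : ℕ) :
    pathExp p v T (fun l => (greedyBudget δ 0 l : ℝ)) + T * ∑ i, p i * v i ≤
      C * expVisitsBelow p v δ (δ + C) T := by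
  induction T with
  | zero => simp [pathExp_zero, greedyBudget, expVisitsBelow]
  | succ T ih =>
    have hstep (b : ℤ) (i : ι) : (greedyStep δ b (v i) : ℝ) ≤
        b + C * (if b < δ + C then 1 else 0) + -v i := by
      have := greedyStep_add_le (δ := δ) hC (hv i) b
      rw [← sub_eq_add_neg, le_sub_iff_add_le]
      exact_mod_cast this
    have hdrift (l : List ℤ) : ∑ i, p i * (greedyBudget δ 0 (l ++ [v i]) : ℝ) ≤
        greedyBudget δ 0 l + C * (if greedyBudget δ 0 l < δ + C then 1 else 0) +
          -∑ i, p i * v i := by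
      simp only [greedyBudget_concat]
      refine (Finset.sum_le_sum fun i _ => mul_le_mul_of_nonneg_left
        (hstep (greedyBudget δ 0 l) i) (hp i)).trans_eq ?_
      simp only [mul_add, Finset.sum_add_distrib, ← Finset.sum_mul, hsum, one_mul, mul_neg,
        Finset.sum_neg_distrib]
    have hnext := pathExp_mono (v := v) hp hdrift T
    rw [pathExp_add, pathExp_add, pathExp_const_mul, pathExp_const hsum] at hnext
    rw [pathExp_succ, expVisitsBelow, Finset.sum_range_succ, ← expVisitsBelow]
    push_cast
    linarith

lemma pathExp_abs_sum_le_greedyBudget {v : ι → ℤ} (hp : ∀ i, 0 ≤ p i) (hsum : ∑ i, p i = 1)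
    (hmean : ∑ i, p i * v i = 0) (hδ : 0 ≤ δ) (hδ1 : δ ≤ 1) (T : ℕ) :
    pathExp p (fun i => (v i : ℝ)) T (fun l => |l.sum|) ≤
      2 * pathExp p v T fun l => (greedyBudget δ 0 l : ℝ) := by
  have habs (l : List ℤ) : |(l.map (Int.cast : ℤ → ℝ)).sum| ≤
      2 * (greedyBudget δ 0 l : ℝ) + (l.map (Int.cast : ℤ → ℝ)).sum := by
    have hsub : 0 - l.sum ≤ greedyBudget δ 0 l := sub_sum_le_greedyBudget hδ hδ1 le_rfl l
    have hint : |l.sum| ≤ 2 * greedyBudget δ 0 l + l.sum :=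
      abs_le'.2 ⟨by linarith [greedyBudget_nonneg hδ le_rfl l], by linarith⟩
    rw [← Int.cast_list_sum]
    exact_mod_cast hint
  have hzero : pathExp p v T (fun l => (l.map (Int.cast : ℤ → ℝ)).sum) = 0 := by
    rw [← pathExp_comp, pathExp_sum hsum, hmean, mul_zero]
  calc pathExp p (fun i => (v i : ℝ)) T (fun l => |l.sum|)
      ≤ pathExp p v T fun l =>
          2 * (greedyBudget δ 0 l : ℝ) + (l.map (Int.cast : ℤ → ℝ)).sum := by
        rw [pathExp_comp]
        exact pathExp_mono hp habs T
    _ = 2 * pathExp p v T fun l => (greedyBudget δ 0 l : ℝ) := by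
        rw [pathExp_add, pathExp_const_mul, hzero, add_zero]

lemma pow_mul_expVisitsBelow_le {p : Fin 3 → ℝ} {m : ℝ} (hm : 0 ≤ m) (hp : ∀ i, m ≤ p i)
    (hsum : ∑ i, p i = 1) (hδ : 0 ≤ δ) (hδ1 : δ ≤ 1) (T : ℕ) :
    m ^ 6 * expVisitsBelow p baseCost δ (δ + 2) T ≤
      6 * pathExp p baseCost (T + 6) fun l => (greedySurplus δ l : ℝ) := by
  have hp0 (i : Fin 3) : 0 ≤ p i := hm.trans (hp i)
  have happend (l w : List ℤ) : (greedySurplus δ l : ℝ) ≤ greedySurplus δ (l ++ w) :=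
    Nat.cast_le.2 (greedySurplus_le_append hδ l w)
  have hpattern (l : List ℤ) (hlow : greedyBudget δ 0 l < δ + 2) : ∃ w : Fin 6 → Fin 3,
      (greedySurplus δ l : ℝ) + 1 ≤ greedySurplus δ (l ++ List.ofFn fun t => baseCost (w t)) := by
    obtain ⟨w, hw⟩ :=
      exists_reaches_greedyCount_add_one hδ hδ1 (greedyBudget_nonneg hδ le_rfl l) hlow
    exact ⟨w, by exact_mod_cast greedySurplus_add_le_append hδ hw⟩
  have hgain (t : ℕ) := pathExp_add_pow_mul_le hm hp hsum happend hpattern t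
  have hnonneg (t : ℕ) : 0 ≤ pathExp p baseCost t fun l => (greedySurplus δ l : ℝ) :=
    pathExp_nonneg hp0 (fun _ => Nat.cast_nonneg _) t
  calc m ^ 6 * expVisitsBelow p baseCost δ (δ + 2) T
      ≤ ∑ t ∈ Finset.range T, (pathExp p baseCost (t + 6) (fun l => (greedySurplus δ l : ℝ)) -
          pathExp p baseCost t fun l => (greedySurplus δ l : ℝ)) := by
        rw [expVisitsBelow, Finset.mul_sum]
        exact Finset.sum_le_sum fun t _ => le_sub_iff_add_le'.2 (hgain t)
    _ ≤ 6 * pathExp p baseCost (T + 6) fun l => (greedySurplus δ l : ℝ) := by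
        exact_mod_cast sum_range_shift_sub_le (monotone_pathExp hp0 hsum happend) hnonneg 6 T

end Drift

lemma Reaches.exists_finset {T : ℕ} {c : Fin T → ℤ} {b b' : ℤ} {n : ℕ}
    (h : Reaches b (List.ofFn c) n b') (hb : 0 ≤ b) :
    ∃ S : Finset (Fin T), S.card = n ∧ ∀ t, (∑ s ∈ S, if s ≤ t then c s else 0) ≤ b := by
  induction T generalizing b n with
  | zero =>
    rw [List.ofFn_zero] at h
    cases h
    exact ⟨∅, rfl, fun t => t.elim0⟩
  | succ T ih =>
    rw [List.ofFn_succ] at h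
    cases h with
    | reject _ h =>
      obtain ⟨S, hcard, hS⟩ := ih h hb
      refine ⟨S.map (Fin.succEmb T), by rwa [Finset.card_map], Fin.cases ?_ fun t => ?_⟩
      · simpa using hb
      · simpa using hS t
    | accept _ hc h =>
      obtain ⟨S, hcard, hS⟩ := ih h (sub_nonneg.2 hc)
      refine ⟨Finset.cons 0 (S.map (Fin.succEmb T)) (by simp), by simp [hcard],
        Fin.cases ?_ fun t => ?_⟩
      · simpa using hc
      · simpa using le_sub_iff_add_le'.1 (hS t)

lemma Reaches.le_hoAny {T : ℕ} {c : Fin T → ℤ} {b' : ℤ} {n : ℕ}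
    (h : Reaches 0 (List.ofFn c) n b') {ε : ℝ} (hε : 0 ≤ ε) : n ≤ hoAny fun t => ε * c t := by
  classical
  obtain ⟨S, rfl, hS⟩ := h.exists_finset le_rfl
  refine Finset.le_sup (f := Finset.card) (Finset.mem_filter.2 ⟨Finset.mem_univ S, fun t => ?_⟩)
  rw [← Finset.mul_sum, Finset.sum_filter]
  exact mul_nonpos_of_nonneg_of_nonpos hε (by exact_mod_cast hS t)

/-- The budget left at the start of period `t` from the initial budget `b`, for integer costs `c`
and decisions `X`. -/
def budgetBefore {T : ℕ} (b : ℤ) (c : Fin T → ℤ) (X : Fin T → Bool) (t : Fin T) : ℤ :=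
  b - ∑ s, if s < t then if X s = true then c s else 0 else 0

lemma budgetBefore_cons_zero {T : ℕ} (b : ℤ) (c : Fin (T + 1) → ℤ) (d : Bool)
    (X : Fin T → Bool) : budgetBefore b c (Fin.cons d X) 0 = b := by
  simp [budgetBefore]

lemma budgetBefore_cons_succ {T : ℕ} (b : ℤ) (c : Fin (T + 1) → ℤ) (d : Bool)
    (X : Fin T → Bool) (t : Fin T) :
    budgetBefore b c (Fin.cons d X) t.succ =
      budgetBefore (if d = true then b - c 0 else b) (fun s => c s.succ) X t := by
  simp only [budgetBefore, Fin.sum_univ_succ, Fin.succ_pos, if_true, Fin.succ_lt_succ_iff,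
    Fin.cons_zero, Fin.cons_succ]
  split_ifs <;> ring

lemma exists_greedy_decisions {δ : ℤ} (hδ : 0 ≤ δ) {T : ℕ} (c : Fin T → ℤ) {b : ℤ} (hb : 0 ≤ b) :
    ∃ X : Fin T → Bool, (∀ t, X t = true ↔ c t + δ ≤ budgetBefore b c X t) ∧
      (∀ t, 0 ≤ budgetBefore b c X t) ∧
      (Finset.univ.filter fun t => X t = true).card = greedyCount δ b (List.ofFn c) := by
  induction T generalizing b with
  | zero => exact ⟨Fin.elim0, fun t => t.elim0, fun t => t.elim0, rfl⟩
  | succ T ih =>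
    obtain ⟨X, hX, hnonneg, hcard⟩ := ih (fun t => c t.succ) (greedyStep_nonneg hδ hb (c 0))
    have hsucc (t : Fin T) : budgetBefore b c (Fin.cons (decide (c 0 + δ ≤ b)) X) t.succ =
        budgetBefore (greedyStep δ b (c 0)) (fun s => c s.succ) X t := by
      simp only [budgetBefore_cons_succ, decide_eq_true_iff, greedyStep]
    refine ⟨Fin.cons (decide (c 0 + δ ≤ b)) X, fun t => ?_, fun t => ?_, ?_⟩
    · cases t using Fin.cases with
      | zero => rw [budgetBefore_cons_zero, Fin.cons_zero, decide_eq_true_iff]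
      | succ t => rw [hsucc, Fin.cons_succ, hX]
    · cases t using Fin.cases with
      | zero => rwa [budgetBefore_cons_zero]
      | succ t => exact hsucc t ▸ hnonneg t
    · rw [Finset.card_filter] at hcard ⊢
      simp only [Fin.sum_univ_succ, Fin.cons_zero, Fin.cons_succ, hcard, List.ofFn_succ,
        greedyCount, decide_eq_true_iff]

/-- The shift that turns the budget test into `c + shift strict ≤ b` for integers `c` and `b`. -/
def shift (strict : Bool) : ℤ := if strict = true then 1 else 0

lemma shift_nonneg (strict : Bool) : 0 ≤ shift strict := by cases strict <;> simp [shift]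

lemma shift_le_one (strict : Bool) : shift strict ≤ 1 := by cases strict <;> simp [shift]

lemma covers_mul_iff {ε : ℝ} (hε : 0 < ε) (strict : Bool) (c b : ℤ) :
    Covers strict (ε * c) (ε * b) ↔ c + shift strict ≤ b := by
  cases strict
  · simp [Covers, shift, hε]
  · simp only [Covers, shift, if_true, mul_lt_mul_iff_right₀ hε, Int.cast_lt, Int.add_one_le_iff]

lemma lastResolve_le {T : ℕ} (R : Finset (Fin T)) (t : Fin T) : lastResolve R t ≤ t := by
  unfold lastResolve
  split_ifs with h
  · exact (Finset.mem_filter.1 (Finset.max'_mem _ h)).2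
  · exact le_rfl

namespace CostDist

variable {α : ℝ} {D : CostDist α}

lemma reducesToGreedy_resolve {T : ℕ} (strict : Bool) (R : Finset (Fin T))
    {g : Fin T → Fin D.k → ℝ → ℝ} {x : ℝ → Fin D.k → ℝ}
    (h : ∀ b, 0 ≤ b → ∀ s i, g s i (x b i) = 1) :
    D.ReducesToGreedy strict (D.resolve T strict R g x) := by
  intro t ω X hbudget
  have hleft : ((lastResolve R t : ℕ) : ℝ) ≤ T := by exact_mod_cast (lastResolve R t).is_lt.le
  simp only [resolve, greedy]
  rw [h]
  exact div_nonneg (hbudget _ (lastResolve_le R t)) (sub_nonneg.2 hleft)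

lemma expReward_eq_of_deterministic {T : ℕ} {π : D.Policy T}
    {X : (Fin T → Fin D.k) → Fin T → Bool}
    (h : ∀ t ω Y, (∀ s < t, Y s = X ω s) → π t ω Y = if X ω t = true then 1 else 0) :
    D.expReward π = ∑ ω : Fin T → Fin D.k, (∏ t, D.p (ω t)) *
      ((Finset.univ.filter fun t => X ω t = true).card : ℝ) := by
  refine Finset.sum_congr rfl fun ω _ => ?_
  rw [Finset.sum_eq_single (X ω) _ fun hX => absurd (Finset.mem_univ _) hX]
  · congr 1
    refine Finset.prod_congr rfl fun t _ => ?_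
    rw [h t ω _ fun _ _ => rfl]
    split_ifs <;> simp
  · intro Y _ hY
    have hne : {t | Y t ≠ X ω t}.Nonempty := Function.ne_iff.1 hY
    -- At the first period where `Y` deviates from `X ω` its decision has probability zero.
    set t := wellFounded_lt.min {t | Y t ≠ X ω t} hne
    have ht : Y t ≠ X ω t := wellFounded_lt.min_mem _ hne
    have hbefore (s : Fin T) (hs : s < t) : Y s = X ω s :=
      not_not.1 fun hs' => wellFounded_lt.not_lt_min _ hs' hs
    have hfactor : (if Y t = true then π t ω Y else 1 - π t ω Y) = 0 := by
      rw [h t ω Y hbefore]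
      cases hYt : Y t <;> cases hXt : X ω t <;> simp_all
    rw [Finset.prod_eq_zero (Finset.mem_univ t) (by rw [hfactor, mul_zero]), zero_mul]

section IntegerCosts

variable {ε : ℝ} {v : Fin D.k → ℤ}

lemma budget_eq_mul_budgetBefore (hv : ∀ i, D.a i = ε * v i) {T : ℕ} (ω : Fin T → Fin D.k)
    (X : Fin T → Bool) (t : Fin T) :
    D.budget ω X t = ε * budgetBefore 0 (fun s => v (ω s)) X t := by
  simp only [budget, budgetBefore, hv, Finset.sum_filter, zero_sub, Int.cast_neg, Int.cast_sum,
    mul_neg, Finset.mul_sum]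
  congr 1
  refine Finset.sum_congr rfl fun s _ => ?_
  split_ifs <;> simp

lemma expReward_eq_pathExp (hε : 0 < ε) (hv : ∀ i, D.a i = ε * v i) {strict : Bool} {T : ℕ}
    {π : D.Policy T} (hπ : D.ReducesToGreedy strict π) :
    D.expReward π = pathExp D.p v T fun l => (greedyCount (shift strict) 0 l : ℝ) := by
  choose X hX hnonneg hcard using fun ω : Fin T → Fin D.k =>
    exists_greedy_decisions (shift_nonneg strict) (fun t => v (ω t)) le_rfl
  rw [expReward_eq_of_deterministic (X := X)]
  · simp only [hcard, pathExp]
  · intro t ω Y hY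
    have hbudget (s : Fin T) (hs : s ≤ t) : D.budget ω Y s = D.budget ω (X ω) s :=
      congrArg Neg.neg <| Finset.sum_congr rfl fun r hr => by
        rw [hY r ((Finset.mem_filter.1 hr).2.trans_le hs)]
    rw [hπ t ω Y fun s hs => ?_, greedy, hbudget t le_rfl, budget_eq_mul_budgetBefore hv, hv]
    · simp only [covers_mul_iff hε, ← hX]
    · rw [hbudget s hs, budget_eq_mul_budgetBefore hv]
      exact mul_nonneg hε.le (by exact_mod_cast hnonneg ω s)

lemma pathExp_greedySurplus_le (hε : 0 < ε) (hv : ∀ i, D.a i = ε * v i) {strict : Bool} {T : ℕ}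
    {π : D.Policy T} (hπ : D.ReducesToGreedy strict π) :
    pathExp D.p v T (fun l => (greedySurplus (shift strict) l : ℝ)) ≤
      D.expHOany T - D.expReward π := by
  rw [le_sub_iff_add_le', expReward_eq_pathExp hε hv hπ, ← pathExp_add]
  refine Finset.sum_le_sum fun ω _ =>
    mul_le_mul_of_nonneg_left ?_ (Finset.prod_nonneg fun _ _ => (D.p_pos _).le)
  simp only [hv]
  exact_mod_cast (reaches_greedySurplus (shift_nonneg strict) _).le_hoAny hε.le

end IntegerCosts

lemma IsDLPSolution.mul_one_sub_le {b : ℝ} {x y : Fin D.k → ℝ} (hx : D.IsDLPSolution b x)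
    (hy : y ∈ D.dlpFeasible b) (i : Fin D.k) :
    D.p i * (1 - x i) ≤ 1 - ∑ j, D.p j * y j := by
  have hopt : ∑ j, D.p j * y j ≤ ∑ j, D.p j * x j := hx.2 hy
  calc D.p i * (1 - x i) ≤ ∑ j, D.p j * (1 - x j) :=
        Finset.single_le_sum (f := fun j => D.p j * (1 - x j))
          (fun j _ => mul_nonneg (D.p_pos j).le (sub_nonneg.2 (hx.1.1 j).2)) (Finset.mem_univ i)
    _ = 1 - ∑ j, D.p j * x j := by simp only [mul_sub, mul_one, Finset.sum_sub_distrib, D.p_sum]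
    _ ≤ 1 - ∑ j, D.p j * y j := sub_le_sub_left hopt 1

lemma mul_one_sub_div_two_pos (h0 : 0 < α) (h1 : α < 1) : 0 < α * (1 - α) / 2 :=
  half_pos (mul_pos h0 (sub_pos.2 h1))

/-- The distribution of the costs `-1`, `1`, `2`, with probabilities `p`, scaled into
`[-α, 1 - α]`. -/
noncomputable def scaledBase (h0 : 0 < α) (h1 : α < 1) (p : Fin 3 → ℝ) (hp : ∀ i, 0 < p i)
    (hsum : ∑ i, p i = 1) : CostDist α where
  k := 3
  a i := α * (1 - α) / 2 * baseCost i
  p := p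
  a_strictMono i j hij := by
    have hbase : StrictMono baseCost := by decide
    exact mul_lt_mul_of_pos_left (Int.cast_lt.2 (hbase hij)) (mul_one_sub_div_two_pos h0 h1)
  a_mem i := by
    fin_cases i <;> simp [baseCost] <;> constructor <;> nlinarith [sub_pos.2 h1]
  exists_nonpos := ⟨0, mul_nonpos_of_nonneg_of_nonpos (mul_one_sub_div_two_pos h0 h1).le
    (by simp [baseCost])⟩
  exists_pos := ⟨1, mul_pos (mul_one_sub_div_two_pos h0 h1) (by simp [baseCost])⟩
  p_pos := hp
  p_sum := hsum

/-- The probabilities for which the costs `-1`, `1`, `2` have mean zero, which makes the linear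
program with zero budget degenerate. -/
noncomputable def criticalProb : Fin 3 → ℝ := ![3 / 5, 1 / 5, 1 / 5]

/-- Probabilities for which the costs `-1`, `1`, `2` have positive mean, while optimal solutions of
the linear program accept every type with probability at least `1 / 2`. -/
noncomputable def supercriticalProb : Fin 3 → ℝ := ![1 / 2, 1 / 4, 1 / 4]

lemma one_fifth_le_criticalProb (i : Fin 3) : 1 / 5 ≤ criticalProb i := by
  fin_cases i <;> norm_num [criticalProb]

lemma one_fourth_le_supercriticalProb (i : Fin 3) : 1 / 4 ≤ supercriticalProb i := by
  fin_cases i <;> norm_num [supercriticalProb]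

lemma criticalProb_pos (i : Fin 3) : 0 < criticalProb i :=
  lt_of_lt_of_le (by norm_num) (one_fifth_le_criticalProb i)

lemma supercriticalProb_pos (i : Fin 3) : 0 < supercriticalProb i :=
  lt_of_lt_of_le (by norm_num) (one_fourth_le_supercriticalProb i)

lemma sum_criticalProb : ∑ i, criticalProb i = 1 := by
  simp only [criticalProb, Fin.sum_univ_three, Matrix.cons_val]
  norm_num

lemma sum_supercriticalProb : ∑ i, supercriticalProb i = 1 := by
  simp only [supercriticalProb, Fin.sum_univ_three, Matrix.cons_val]
  norm_num

lemma sum_criticalProb_mul_baseCost : ∑ i, criticalProb i * baseCost i = 0 := by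
  simp only [criticalProb, baseCost, Fin.sum_univ_three, Matrix.cons_val]
  norm_num

lemma sum_supercriticalProb_mul_baseCost : ∑ i, supercriticalProb i * baseCost i = 1 / 4 := by
  simp only [supercriticalProb, baseCost, Fin.sum_univ_three, Matrix.cons_val]
  norm_num

lemma baseCost_le_two (i : Fin 3) : baseCost i ≤ 2 := by
  fin_cases i <;> decide

/-- The degenerate instance: the costs `-1`, `1`, `2` with mean zero, scaled. -/
noncomputable def critical (h0 : 0 < α) (h1 : α < 1) : CostDist α :=
  scaledBase h0 h1 criticalProb criticalProb_pos sum_criticalProb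

/-- The instance on which the Bayes selector loses linearly: the costs `-1`, `1`, `2` with positive
mean, scaled. -/
noncomputable def supercritical (h0 : 0 < α) (h1 : α < 1) : CostDist α :=
  scaledBase h0 h1 supercriticalProb supercriticalProb_pos sum_supercriticalProb

section Surplus

variable {δ : ℤ}

lemma sqrt_le_two_mul_criticalProb_abs_sum (T : ℕ) :
    √T ≤ 2 * pathExp criticalProb (fun i => (baseCost i : ℝ)) T fun l => |l.sum| := by
  have hp0 (i : Fin 3) : 0 ≤ criticalProb i := (criticalProb_pos i).le
  have hsq : ∑ i, criticalProb i * (baseCost i : ℝ) ^ 2 = 8 / 5 := by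
    simp only [criticalProb, baseCost, Fin.sum_univ_three, Matrix.cons_val]
    norm_num
  have hfour : ∑ i, criticalProb i * (baseCost i : ℝ) ^ 4 = 4 := by
    simp only [criticalProb, baseCost, Fin.sum_univ_three, Matrix.cons_val]
    norm_num
  have hlower := pathExp_abs_sum_sq_ge hp0 sum_criticalProb sum_criticalProb_mul_baseCost T
  rw [hsq, hfour] at hlower
  refine Real.sqrt_le_iff.2 ⟨?_, by nlinarith⟩
  exact mul_nonneg zero_le_two (pathExp_nonneg hp0 (fun _ => abs_nonneg _) T)

lemma critical_surplus_ge (hδ : 0 ≤ δ) (hδ1 : δ ≤ 1) (T : ℕ) :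
    (1 / 5) ^ 6 / 48 * √T ≤
      pathExp criticalProb baseCost (T + 6) fun l => (greedySurplus δ l : ℝ) := by
  have hp0 (i : Fin 3) : 0 ≤ criticalProb i := (criticalProb_pos i).le
  have hwalk := sqrt_le_two_mul_criticalProb_abs_sum T
  have habs := pathExp_abs_sum_le_greedyBudget hp0 sum_criticalProb sum_criticalProb_mul_baseCost
    hδ hδ1 T
  have hdrift := pathExp_greedyBudget_add_le (δ := δ) hp0 sum_criticalProb zero_le_two
    baseCost_le_two T
  have hpattern := pow_mul_expVisitsBelow_le (by norm_num) one_fifth_le_criticalProb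
    sum_criticalProb hδ hδ1 T
  rw [sum_criticalProb_mul_baseCost] at hdrift
  push_cast at hdrift
  linarith

lemma supercritical_surplus_ge (hδ : 0 ≤ δ) (hδ1 : δ ≤ 1) (T : ℕ) :
    (1 / 4) ^ 6 / 48 * T ≤
      pathExp supercriticalProb baseCost (T + 6) fun l => (greedySurplus δ l : ℝ) := by
  have hp0 (i : Fin 3) : 0 ≤ supercriticalProb i := (supercriticalProb_pos i).le
  have hbudget : 0 ≤ pathExp supercriticalProb baseCost T fun l => (greedyBudget δ 0 l : ℝ) :=
    pathExp_nonneg hp0 (fun l => Int.cast_nonneg (greedyBudget_nonneg hδ le_rfl l)) T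
  have hdrift := pathExp_greedyBudget_add_le (δ := δ) hp0 sum_supercriticalProb zero_le_two
    baseCost_le_two T
  have hpattern := pow_mul_expVisitsBelow_le (by norm_num) one_fourth_le_supercriticalProb
    sum_supercriticalProb hδ hδ1 T
  rw [sum_supercriticalProb_mul_baseCost] at hdrift
  push_cast at hdrift
  linarith

end Surplus

section Instances

variable (h0 : 0 < α) (h1 : α < 1)

lemma critical_degenerate : (critical h0 h1).Degenerate := by
  refine ⟨(2 : Fin 3), mul_pos (mul_one_sub_div_two_pos h0 h1) (by simp [baseCost]), ?_⟩
  have hall : (Finset.univ.filter fun j : Fin 3 => j ≤ 2) = Finset.univ := by decide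
  calc (critical h0 h1).cumCost (2 : Fin 3)
      = ∑ j ∈ Finset.univ.filter fun j : Fin 3 => j ≤ 2,
          criticalProb j * (α * (1 - α) / 2 * baseCost j) := rfl
    _ = α * (1 - α) / 2 * ∑ j, criticalProb j * baseCost j := by
      simp only [hall, mul_left_comm, Finset.mul_sum]
    _ = 0 := by rw [sum_criticalProb_mul_baseCost, mul_zero]

variable {h0 h1}

lemma mem_dlpFeasible_scaledBase {p : Fin 3 → ℝ} {hp : ∀ i, 0 < p i} {hsum : ∑ i, p i = 1}
    {b : ℝ} (hb : 0 ≤ b) {y : Fin 3 → ℝ} (hy : ∀ i, 0 ≤ y i ∧ y i ≤ 1)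
    (hcost : ∑ i, baseCost i * p i * y i ≤ 0) :
    y ∈ (scaledBase h0 h1 p hp hsum).dlpFeasible b := by
  refine ⟨hy, le_trans ?_ hb⟩
  calc ∑ i : Fin 3, α * (1 - α) / 2 * baseCost i * p i * y i
      = α * (1 - α) / 2 * ∑ i, baseCost i * p i * y i := by simp only [mul_assoc, Finset.mul_sum]
    _ ≤ 0 := mul_nonpos_of_nonneg_of_nonpos (mul_one_sub_div_two_pos h0 h1).le hcost

lemma critical_solution_eq_one {b : ℝ} (hb : 0 ≤ b) {x : Fin 3 → ℝ}
    (hx : (critical h0 h1).IsDLPSolution b x) (i : Fin 3) : x i = 1 := by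
  have hones : (fun _ => 1) ∈ (critical h0 h1).dlpFeasible b :=
    mem_dlpFeasible_scaledBase hb (fun _ => ⟨zero_le_one, le_rfl⟩)
      (by simp only [criticalProb, baseCost, Fin.sum_univ_three, Matrix.cons_val]; norm_num)
  have hslack : criticalProb i * (1 - x i) ≤ 1 - ∑ j, criticalProb j * 1 :=
    hx.mul_one_sub_le hones i
  have hle : x i ≤ 1 := (hx.1.1 i).2
  have hpos := one_fifth_le_criticalProb i
  simp only [mul_one, sum_criticalProb, sub_self] at hslack
  nlinarith

lemma half_le_supercritical_solution {b : ℝ} (hb : 0 ≤ b) {x : Fin 3 → ℝ}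
    (hx : (supercritical h0 h1).IsDLPSolution b x) (i : Fin 3) : 1 / 2 ≤ x i := by
  have hfeasible : (![1, 1, 1 / 2] : Fin 3 → ℝ) ∈ (supercritical h0 h1).dlpFeasible b :=
    mem_dlpFeasible_scaledBase hb (fun j => by fin_cases j <;> norm_num)
      (by simp only [supercriticalProb, baseCost, Fin.sum_univ_three, Matrix.cons_val]; norm_num)
  have hslack : supercriticalProb i * (1 - x i) ≤
      1 - ∑ j, supercriticalProb j * (![1, 1, 1 / 2] : Fin 3 → ℝ) j :=
    hx.mul_one_sub_le hfeasible i
  have hvalue : ∑ j, supercriticalProb j * (![1, 1, 1 / 2] : Fin 3 → ℝ) j = 7 / 8 := by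
    simp only [supercriticalProb, Fin.sum_univ_three, Matrix.cons_val]
    norm_num
  have hle : x i ≤ 1 := (hx.1.1 i).2
  have hpos := one_fourth_le_supercriticalProb i
  rw [hvalue] at hslack
  nlinarith

lemma critical_gap {T : ℕ} (hT : 12 ≤ T) {strict : Bool} {π : (critical h0 h1).Policy T}
    (hπ : (critical h0 h1).ReducesToGreedy strict π) :
    (1 / 5) ^ 6 / 96 * √T ≤ (critical h0 h1).expHOany T - (critical h0 h1).expReward π := by
  obtain ⟨N, rfl⟩ := Nat.exists_eq_add_of_le' (show 6 ≤ T by omega)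
  have hN : ((N + 6 : ℕ) : ℝ) ≤ 2 ^ 2 * N := by norm_cast; omega
  have hsqrt : √(N + 6 : ℕ) ≤ 2 * √N := by
    simpa using Real.sqrt_le_sqrt hN
  calc (1 / 5) ^ 6 / 96 * √(N + 6 : ℕ) ≤ (1 / 5) ^ 6 / 48 * √N := by linarith
    _ ≤ pathExp criticalProb baseCost (N + 6) fun l => (greedySurplus (shift strict) l : ℝ) :=
      critical_surplus_ge (shift_nonneg strict) (shift_le_one strict) N
    _ ≤ (critical h0 h1).expHOany (N + 6) - (critical h0 h1).expReward π :=
      pathExp_greedySurplus_le (mul_one_sub_div_two_pos h0 h1) (fun _ => rfl) hπ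

lemma supercritical_gap {T : ℕ} (hT : 12 ≤ T) {strict : Bool} {π : (supercritical h0 h1).Policy T}
    (hπ : (supercritical h0 h1).ReducesToGreedy strict π) :
    (1 / 4) ^ 6 / 96 * T ≤
      (supercritical h0 h1).expHOany T - (supercritical h0 h1).expReward π := by
  obtain ⟨N, rfl⟩ := Nat.exists_eq_add_of_le' (show 6 ≤ T by omega)
  have hN : ((N + 6 : ℕ) : ℝ) ≤ 2 * N := by norm_cast; omega
  calc (1 / 4) ^ 6 / 96 * ((N + 6 : ℕ) : ℝ) ≤ (1 / 4) ^ 6 / 48 * N := by linarith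
    _ ≤ pathExp supercriticalProb baseCost (N + 6) fun l =>
          (greedySurplus (shift strict) l : ℝ) :=
      supercritical_surplus_ge (shift_nonneg strict) (shift_le_one strict) N
    _ ≤ (supercritical h0 h1).expHOany (N + 6) - (supercritical h0 h1).expReward π :=
      pathExp_greedySurplus_le (mul_one_sub_div_two_pos h0 h1) (fun _ => rfl) hπ

end Instances

end CostDist

theorem proposition3_general (α : ℝ) (hα0 : 0 < α) (hα1 : α < 1) :
    (∃ D : CostDist α, D.Degenerate ∧
      (∀ (T : ℕ) (strict : Bool) (R : Finset (Fin T)) (g : Fin T → Fin D.k → ℝ → ℝ)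
        (x : ℝ → Fin D.k → ℝ),
        (∀ t, ∃ s ∈ R, s ≤ t) → (∀ s i, g s i 1 = 1) → D.IsDLPSolver x →
        D.ReducesToGreedy strict (D.resolve T strict R g x)) ∧
      ∃ c : ℝ, 0 < c ∧ ∃ T₀ : ℕ, ∀ T : ℕ, T₀ ≤ T → ∀ (strict : Bool) (π : D.Policy T),
        D.ReducesToGreedy strict π → c * Real.sqrt T ≤ D.expHOany T - D.expReward π) ∧
    (∃ D : CostDist α, ∃ c : ℝ, 0 < c ∧ ∃ T₀ : ℕ, ∀ T : ℕ, T₀ ≤ T →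
      ∀ (strict : Bool) (R : Finset (Fin T)) (g : Fin T → Fin D.k → ℝ → ℝ)
        (x : ℝ → Fin D.k → ℝ),
        (∀ t, ∃ s ∈ R, s ≤ t) → (∀ s i y, 1 / 2 ≤ y → g s i y = 1) → D.IsDLPSolver x →
        c * (T : ℝ) ≤ D.expHOany T - D.expReward (D.resolve T strict R g x)) := by
  refine ⟨⟨.critical hα0 hα1, CostDist.critical_degenerate hα0 hα1, ?_,
    (1 / 5) ^ 6 / 96, by norm_num, 12, fun T hT strict π => CostDist.critical_gap hT⟩,
    .supercritical hα0 hα1, (1 / 4) ^ 6 / 96, by norm_num, 12, ?_⟩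
  · intro T strict R g x _ hg hx
    refine CostDist.reducesToGreedy_resolve strict R fun b hb s i => ?_
    rw [CostDist.critical_solution_eq_one hb (hx b hb) i, hg]
  · intro T hT strict R g x _ hg hx
    exact CostDist.supercritical_gap hT <| CostDist.reducesToGreedy_resolve strict R
      fun b hb s i => hg s i _ (CostDist.half_le_supercritical_solution hb (hx b hb) i)

theorem proposition3 (α : ℝ) (hα0 : 0 < α) (hα1 : α < 1) :
    (∃ D : CostDist α, D.Degenerate ∧
      (∀ (T : ℕ) (strict : Bool) (R : Finset (Fin T)) (g : Fin T → Fin D.k → ℝ → ℝ)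
        (x : ℝ → Fin D.k → ℝ),
        (∀ t, ∃ s ∈ R, s ≤ t) → (∀ s i, IsTruncation (g s i)) → D.IsDLPSolver x →
        D.ReducesToGreedy strict (D.FR T strict x) ∧
        D.ReducesToGreedy strict (D.IFR T strict R g x) ∧
        D.ReducesToGreedy strict (D.FRT T strict g x) ∧
        D.ReducesToGreedy strict (D.Bayes T strict x)) ∧
      ∃ c : ℝ, 0 < c ∧ ∃ T₀ : ℕ, ∀ T : ℕ, T₀ ≤ T →
        ∀ (strict : Bool) (R : Finset (Fin T)) (g : Fin T → Fin D.k → ℝ → ℝ)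
          (x : ℝ → Fin D.k → ℝ),
        (∀ t, ∃ s ∈ R, s ≤ t) → (∀ s i, IsTruncation (g s i)) → D.IsDLPSolver x →
        c * Real.sqrt T ≤ D.expHOany T -
          max (max (D.expReward (D.FR T strict x)) (D.expReward (D.IFR T strict R g x)))
            (max (D.expReward (D.FRT T strict g x)) (D.expReward (D.Bayes T strict x)))) ∧
    (∃ D : CostDist α, ∃ c : ℝ, 0 < c ∧ ∃ T₀ : ℕ, ∀ T : ℕ, T₀ ≤ T →
      ∀ (strict : Bool) (x : ℝ → Fin D.k → ℝ), D.IsDLPSolver x →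
        c * (T : ℝ) ≤ D.expHOany T - D.expReward (D.Bayes T strict x)) := by
  classical
  obtain ⟨⟨D, hdeg, hgreedy, c, hc, T₀, hgap⟩, E, c', hc', T₁, hgap'⟩ :=
    proposition3_general α hα0 hα1
  have huniv (T : ℕ) (t : Fin T) : ∃ s ∈ Finset.univ, s ≤ t := ⟨t, Finset.mem_univ t, le_rfl⟩
  have hheuristics (T : ℕ) (strict : Bool) (R : Finset (Fin T)) (g : Fin T → Fin D.k → ℝ → ℝ)
      (x : ℝ → Fin D.k → ℝ) (hR : ∀ t, ∃ s ∈ R, s ≤ t)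
      (hg : ∀ s i, IsTruncation (g s i)) (hx : D.IsDLPSolver x) :
      D.ReducesToGreedy strict (D.FR T strict x) ∧ D.ReducesToGreedy strict (D.IFR T strict R g x) ∧
        D.ReducesToGreedy strict (D.FRT T strict g x) ∧
          D.ReducesToGreedy strict (D.Bayes T strict x) :=
    ⟨hgreedy T strict _ _ x (huniv T) (fun _ _ => rfl) hx,
      hgreedy T strict R g x hR (fun s i => (hg s i).2.1) hx,
      hgreedy T strict _ g x (huniv T) (fun s i => (hg s i).2.1) hx,
      hgreedy T strict _ _ x (huniv T) (fun _ _ => if_pos (by norm_num)) hx⟩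
  refine ⟨⟨D, hdeg, hheuristics, c, hc, T₀, ?_⟩,
    E, c', hc', T₁, fun T hT strict x => hgap' T hT strict _ _ x (huniv T) fun _ _ _ h => if_pos h⟩
  intro T hT strict R g x hR hg hx
  obtain ⟨hFR, hIFR, hFRT, hBayes⟩ := hheuristics T strict R g x hR hg hx
  have hle {π : D.Policy T} (hπ : D.ReducesToGreedy strict π) :=
    le_sub_comm.1 (hgap T hT strict π hπ)
  exact le_sub_comm.1 (max_le (max_le (hle hFR) (hle hIFR)) (max_le (hle hFRT) (hle hBayes)))
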